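/- Let $\phi:\mathbb{R}^n\to\mathbb{R}$ be twice continuously differentiable and strongly convex with parameter $\mu>0$, attaining its minimum value $\phi^*$, and suppose that $\nabla\phi$ is Lipschitz continuous with constant $L>0$. Let $\alpha,\beta>0$ and let $\lambda\in[0,1]$ satisfy $\lambda\le\frac{1}{2\alpha}$. For every $z\in\mathbb{R}^n$ there is a unique function $x_z\in\mathcal{C}^2((0,\infty);\mathbb{R}^n)\cap\mathcal{C}^1([0,\infty);\mathbb{R}^n)$ such that $x_z(0)=z$, $\dot x_z(0)=0$ and $$\ddot{x}_z(t)+\frac{\alpha}{t}\dot{x}_z(t)+\beta\nabla^2\phi(x_z(t))\dot{x}_z(t)+\nabla\phi(x_z(t))=0\qquad\text{for every } t>0.$$ Define the $\lambda$-extended speed restarting time, with the convention $\inf\emptyset=+\infty$, by $$T^\lambda(z)=\inf\Big\{t>0:\ \frac12\frac{d}{dt}\|\dot x_z(t)\|^2+\lambda\frac{\alpha}{t}\|\dot x_z(t)\|^2\le 0\Big\}.$$ Then the $\lambda$-extended speed restarting scheme is proper, that is: (i) there exist $\tau_*,\tau^*>0$ such that $\tau_*\le T^\lambda(z)\le\tau^*$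 for every $z\notin\operatorname{argmin}(\phi)$; (ii) for every $z\in\mathbb{R}^n$, the function $t\mapsto\phi(x_z(t))$ is nonincreasing on $[0,T^\lambda(z)]$; (iii) there exists $Q\in(0,1)$ such that $\phi\big(x_z(T^\lambda(z))\big)-\phi^*\le Q\,\big(\phi(z)-\phi^*\big)$ for every $z\notin\operatorname{argmin}(\phi)$. -/

import Mathlib

open Set
open scoped NNReal ENNReal

noncomputable section

namespace DinAvd

/-- The set of global minimizers of `φ`. -/
def argmin {E : Type*} (φ : E → ℝ) : Set E := {z | IsMinOn φ univ z}

/-- The Hessian `∇²φ(x)`, as a continuous linear map: the derivative of the gradient. -/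
def hessian {n : ℕ} (φ : EuclideanSpace ℝ (Fin n) → ℝ) (x : EuclideanSpace ℝ (Fin n)) :
    EuclideanSpace ℝ (Fin n) →L[ℝ] EuclideanSpace ℝ (Fin n) :=
  fderiv ℝ (gradient φ) x

/-- `x` (of which only the restriction to `[0, ∞)` matters) is a lazy solution, starting from `z`,
of `x'' + (α / t) x' + β ∇²φ(x) x' + ∇φ(x) = 0`:
it is `C²` on `(0, ∞)` and `C¹` on `[0, ∞)`, `x(0) = z`, `x'(0) = 0` (one-sided derivative),
and the equation holds for every `t > 0`. -/
structure IsSolution {n : ℕ} (φ : EuclideanSpace ℝ (Fin n) → ℝ) (α β : ℝ)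
    (z : EuclideanSpace ℝ (Fin n)) (x : ℝ → EuclideanSpace ℝ (Fin n)) : Prop where
  contDiffOn_two : ContDiffOn ℝ 2 x (Ioi 0)
  contDiffOn_one : ContDiffOn ℝ 1 x (Ici 0)
  init : x 0 = z
  init_deriv : HasDerivWithinAt x 0 (Ici 0) 0
  eqn : ∀ t : ℝ, 0 < t →
    deriv (deriv x) t + (α / t) • deriv x t + β • hessian φ (x t) (deriv x t)
      + gradient φ (x t) = 0

/-- The restarting criterion
`(1/2) d/dt ‖x'(t)‖² + lam (α / t) ‖x'(t)‖²` along a trajectory `x`, for `t > 0`. -/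
def speedCriterion {n : ℕ} (α lam : ℝ) (x : ℝ → EuclideanSpace ℝ (Fin n)) (t : ℝ) : ℝ :=
  1 / 2 * deriv (fun s => ‖deriv x s‖ ^ 2) t + lam * (α / t) * ‖deriv x t‖ ^ 2

/-- The `lam`-extended speed restarting time of a trajectory `x`: the infimum in `[0, ∞]` of the
times `t > 0` at which the criterion is nonpositive (so it is `∞` if there is no such time). -/
def restartTime {n : ℕ} (α lam : ℝ) (x : ℝ → EuclideanSpace ℝ (Fin n)) : ℝ≥0∞ :=
  sInf (ENNReal.ofReal '' {t : ℝ | 0 < t ∧ speedCriterion α lam x t ≤ 0})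

/-- The restarting scheme with trajectories `x z` and restarting times `T z` is proper for the
objective function `φ` with minimum value `φmin`. -/
structure IsProper {n : ℕ} (φ : EuclideanSpace ℝ (Fin n) → ℝ) (φmin : ℝ)
    (x : EuclideanSpace ℝ (Fin n) → ℝ → EuclideanSpace ℝ (Fin n))
    (T : EuclideanSpace ℝ (Fin n) → ℝ≥0∞) : Prop where
  bounds : ∃ τlow τup : ℝ, 0 < τlow ∧ 0 < τup ∧
    ∀ z, z ∉ argmin φ → ENNReal.ofReal τlow ≤ T z ∧ T z ≤ ENNReal.ofReal τup
  nonincreasing : ∀ z, AntitoneOn (fun t => φ (x z t)) {t : ℝ | 0 ≤ t ∧ ENNReal.ofReal t ≤ T z}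
  contraction : ∃ Q : ℝ, 0 < Q ∧ Q < 1 ∧
    ∀ z, z ∉ argmin φ → φ (x z (T z).toReal) - φmin ≤ Q * (φ z - φmin)

end DinAvd

end

/-! Existence and uniqueness: the unknown `x' + β∇φ(x)` satisfies `y' = (α/t)((β - t/α)∇φ(x) - y)`,
so it is a weighted average of `(β - s/α)∇φ(x(s))` over `[0, t]`. This removes both the singularity
and the Hessian, and leaves an integral equation with Lipschitz data, contractive in an
exponentially weighted norm (`exists_hasDerivAt_velocity`, `IsTrajectory.eqOn`).

Lower bound on the restarting time: near `0`, `x'(t)` is close to `-(t/(α+1))∇φ(z)` and `x''(t)` to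
`-(1/(α+1))∇φ(z)`, with relative errors controlled by `α, β, L, t` only. So the criterion is
positive up to some `τ` independent of `z` (`IsSolution.early_estimates`).

Decrease: pairing the equation with `x'` while the criterion is nonnegative gives `(φ ∘ x)' ≤
-βμ‖x'‖²` (`IsSolution.inner_gradient_le`). Since `‖x'(t)‖` is at least a multiple of `t‖∇φ(z)‖` on
`(0, τ]`, the inequality `2μ(φ(z) - φ*) ≤ ‖∇φ(z)‖²` turns the loss up to `τ` into a fixed fraction
of the gap.

Upper bound: as `λα ≤ 1/2`, `t‖x'(t)‖²` does not decrease before the restart, so `φ` loses at least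
`c/t` per unit time after `τ`. The loss grows like `log t` and would exceed the initial gap
(`IsSolution.decrease_log`). -/

namespace DinAvd

open Filter Topology

/-! ### Strong convexity: first- and second-order consequences. -/

section Convexity

variable {E : Type*} [NormedAddCommGroup E] [InnerProductSpace ℝ E] [CompleteSpace E]

theorem hasDerivAt_comp_add_smul {φ : E → ℝ} {x : E} (h : DifferentiableAt ℝ φ x) (v : E) :
    HasDerivAt (fun s : ℝ => φ (x + s • v)) (inner ℝ (gradient φ x) v) 0 := by
  have h1 : HasDerivAt (fun s : ℝ => x + s • v) v 0 := by
    simpa using ((hasDerivAt_id (0 : ℝ)).smul_const v).const_add x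
  have h2 : HasFDerivAt φ (fderiv ℝ φ x) (x + (0 : ℝ) • v) := by
    simpa using h.hasFDerivAt
  have h3 := h2.comp_hasDerivAt (0 : ℝ) h1
  have h4 : fderiv ℝ φ x v = inner ℝ (gradient φ x) v := by
    rw [gradient, InnerProductSpace.toDual_symm_apply]
  rw [← h4]
  exact h3

theorem add_inner_gradient_add_le {φ : E → ℝ} {μ : ℝ} (hconv : StrongConvexOn univ μ φ) {x : E}
    (h : DifferentiableAt ℝ φ x) (y : E) :
    φ x + inner ℝ (gradient φ x) (y - x) + μ / 2 * ‖y - x‖ ^ 2 ≤ φ y := by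
  have hd := (hasDerivAt_comp_add_smul h (y - x)).tendsto_slope_zero_right
  have hr : Tendsto (fun s : ℝ => φ y - φ x - (1 - s) * (μ / 2 * ‖y - x‖ ^ 2)) (𝓝[>] 0)
      (𝓝 (φ y - φ x - (1 - 0) * (μ / 2 * ‖y - x‖ ^ 2))) := by
    apply Tendsto.mono_left _ nhdsWithin_le_nhds
    exact Continuous.tendsto (by fun_prop) 0
  have hle := le_of_tendsto_of_tendsto hd hr (by
    filter_upwards [Ioo_mem_nhdsGT (zero_lt_one (α := ℝ))] with s hs
    have hc := hconv.2 (mem_univ x) (mem_univ y) (by linarith [hs.2] : 0 ≤ 1 - s) hs.1.le (by ring)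
    have e : (1 - s) • x + s • y = x + s • (y - x) := by
      rw [sub_smul, smul_sub, one_smul]; abel
    rw [e] at hc
    have hn : ‖x - y‖ = ‖y - x‖ := norm_sub_rev x y
    simp only [hn, smul_eq_mul] at hc
    simp only [zero_add, zero_smul, add_zero, smul_eq_mul]
    rw [inv_mul_le_iff₀ hs.1]
    nlinarith [hc])
  linarith

theorem mul_norm_sq_le_inner_gradient_sub {φ : E → ℝ} {μ : ℝ} (hconv : StrongConvexOn univ μ φ)
    (h : Differentiable ℝ φ) (x y : E) :
    μ * ‖y - x‖ ^ 2 ≤ inner ℝ (gradient φ y - gradient φ x) (y - x) := by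
  have h1 := add_inner_gradient_add_le hconv (h x) y
  have h2 := add_inner_gradient_add_le hconv (h y) x
  have e : inner ℝ (gradient φ y) (x - y) = -inner ℝ (gradient φ y) (y - x) := by
    rw [← inner_neg_right, neg_sub]
  rw [e, norm_sub_rev x y] at h2
  rw [inner_sub_left]
  linarith

/-- The quadratic minorant at `x` is bounded below by its minimum over all displacements; completing
the square gives the Polyak–Łojasiewicz inequality. -/
theorem two_mul_mul_sub_le_norm_gradient_sq {φ : E → ℝ} {μ : ℝ} (hμ : 0 < μ)
    (hconv : StrongConvexOn univ μ φ) {x : E} (h : DifferentiableAt ℝ φ x) (y : E) :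
    2 * μ * (φ x - φ y) ≤ ‖gradient φ x‖ ^ 2 := by
  have h1 := add_inner_gradient_add_le hconv h y
  have h2 := neg_le_of_abs_le (abs_real_inner_le_norm (gradient φ x) (y - x))
  nlinarith [sq_nonneg (‖gradient φ x‖ - μ * ‖y - x‖)]

theorem contDiff_gradient {φ : E → ℝ} (hφ : ContDiff ℝ 2 φ) : ContDiff ℝ 1 (gradient φ) := by
  have h : ContDiff ℝ 1 (fderiv ℝ φ) := hφ.fderiv_right (by norm_num)
  exact (InnerProductSpace.toDual ℝ E).symm.contDiff.comp h

omit [CompleteSpace E] in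
theorem mul_norm_sq_le_inner_fderiv {G : E → E} {μ : ℝ} {x : E} (h : DifferentiableAt ℝ G x)
    (hG : ∀ y, μ * ‖y - x‖ ^ 2 ≤ inner ℝ (G y - G x) (y - x)) (v : E) :
    μ * ‖v‖ ^ 2 ≤ inner ℝ (fderiv ℝ G x v) v := by
  have h1 : HasDerivAt (fun s : ℝ => x + s • v) v 0 := by
    simpa using ((hasDerivAt_id (0 : ℝ)).smul_const v).const_add x
  have h2 : HasFDerivAt G (fderiv ℝ G x) (x + (0 : ℝ) • v) := by
    simpa using h.hasFDerivAt
  have h3 := (h2.comp_hasDerivAt (0 : ℝ) h1).tendsto_slope_zero_right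
  have h4 := h3.inner (tendsto_const_nhds (x := v)) (𝕜 := ℝ)
  refine ge_of_tendsto h4 ?_
  filter_upwards [self_mem_nhdsWithin] with s hs
  have hs' : (0 : ℝ) < s := hs
  have := hG (x + s • v)
  simp only [add_sub_cancel_left, norm_smul, inner_smul_right, Real.norm_eq_abs, abs_of_pos hs'] at this
  simp only [Function.comp, zero_add, zero_smul, add_zero, real_inner_smul_left]
  rw [← div_eq_inv_mul, le_div_iff₀ hs']
  nlinarith

end Convexity

/-! ### Weighted averages and the singular equation `y' = (α/t)(f - y)`. -/

section PowerMean

variable {E : Type*} [NormedAddCommGroup E] [NormedSpace ℝ E]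

/-- The average of `f` over `[0, t]` with density proportional to `σ ^ (α - 1)`, after the change of
variables `σ = t * r ^ (1 / α)`. -/
noncomputable def powerMean (α : ℝ) (f : ℝ → E) (t : ℝ) : E :=
  ∫ r in (0 : ℝ)..1, f (t * r ^ (1 / α))

variable {α : ℝ}

theorem continuous_rpow_inv (hα : 0 < α) : Continuous fun r : ℝ => r ^ (1 / α) :=
  continuous_id.rpow_const fun _ => Or.inr (by positivity)

theorem continuous_powerMean (hα : 0 < α) {f : ℝ → E} (hf : Continuous f) :
    Continuous (powerMean α f) := by
  apply intervalIntegral.continuous_parametric_intervalIntegral_of_continuous'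
  have := continuous_rpow_inv hα
  simp only [Function.uncurry_def]
  fun_prop

theorem mul_rpow_inv_mem_Icc (hα : 0 < α) {t r : ℝ} (ht : 0 ≤ t) (hr : r ∈ Icc (0 : ℝ) 1) :
    t * r ^ (1 / α) ∈ Icc 0 t :=
  ⟨mul_nonneg ht (Real.rpow_nonneg hr.1 _),
    mul_le_of_le_one_right ht (Real.rpow_le_one hr.1 hr.2 (by positivity))⟩

theorem powerMean_congr (hα : 0 < α) {f g : ℝ → E} {t : ℝ} (ht : 0 ≤ t)
    (h : EqOn f g (Icc 0 t)) : powerMean α f t = powerMean α g t := by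
  refine intervalIntegral.integral_congr fun r hr => ?_
  rw [uIcc_of_le zero_le_one] at hr
  exact h (mul_rpow_inv_mem_Icc hα ht hr)

theorem norm_powerMean_le (hα : 0 < α) {f : ℝ → E} {t C : ℝ} (ht : 0 ≤ t)
    (h : ∀ s ∈ Icc 0 t, ‖f s‖ ≤ C) : ‖powerMean α f t‖ ≤ C := by
  have := intervalIntegral.norm_integral_le_of_norm_le_const (a := 0) (b := 1)
    (f := fun r : ℝ => f (t * r ^ (1 / α))) (C := C) (fun r hr => by
      rw [uIoc_of_le zero_le_one] at hr
      exact h _ (mul_rpow_inv_mem_Icc hα ht ⟨hr.1.le, hr.2⟩))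
  simpa [powerMean] using this

theorem powerMean_sub (hα : 0 < α) {f g : ℝ → E} (hf : Continuous f) (hg : Continuous g) (t : ℝ) :
    powerMean α (fun s => f s - g s) t = powerMean α f t - powerMean α g t := by
  have := continuous_rpow_inv hα
  apply intervalIntegral.integral_sub <;> exact Continuous.intervalIntegrable (by fun_prop) _ _

variable [CompleteSpace E]

theorem powerMean_zero (α : ℝ) (f : ℝ → E) : powerMean α f 0 = f 0 := by
  simp [powerMean]

omit [CompleteSpace E] in
-- Substituting `ρ = t ^ α * r` moves `t` out of the integrand, so differentiation in `t` needs only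
-- continuity of `f`.
theorem powerMean_eq (hα : 0 < α) (f : ℝ → E) {t : ℝ} (ht : 0 < t) :
    powerMean α f t = (t ^ (-α)) • ∫ ρ in (0 : ℝ)..(t ^ α), f (ρ ^ (1 / α)) := by
  have hp : 0 < t ^ α := Real.rpow_pos_of_pos ht _
  have h := intervalIntegral.integral_comp_mul_left (a := 0) (b := 1) (fun ρ => f (ρ ^ (1 / α)))
    hp.ne'
  rw [mul_zero, mul_one] at h
  rw [Real.rpow_neg ht.le, ← h, powerMean]
  refine intervalIntegral.integral_congr fun r hr => ?_
  rw [uIcc_of_le zero_le_one] at hr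
  rw [Real.mul_rpow hp.le hr.1, ← Real.rpow_mul ht.le, mul_one_div_cancel hα.ne', Real.rpow_one]

theorem hasDerivAt_powerMean (hα : 0 < α) {f : ℝ → E} (hf : Continuous f) {t : ℝ} (ht : 0 < t) :
    HasDerivAt (powerMean α f) ((α / t) • (f t - powerMean α f t)) t := by
  have hc : Continuous fun ρ : ℝ => f (ρ ^ (1 / α)) := hf.comp (continuous_rpow_inv hα)
  have h1 : HasDerivAt (fun s : ℝ => s ^ α) (α * t ^ (α - 1)) t :=
    Real.hasDerivAt_rpow_const (Or.inl ht.ne')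
  have h2 : HasDerivAt (fun s : ℝ => s ^ (-α)) (-α * t ^ (-α - 1)) t :=
    Real.hasDerivAt_rpow_const (Or.inl ht.ne')
  have h3 := (hc.integral_hasStrictDerivAt 0 (t ^ α)).hasDerivAt.scomp t h1
  have h4 := h2.smul h3
  have h5 : powerMean α f =ᶠ[𝓝 t]
      fun s => (s ^ (-α)) • ∫ ρ in (0 : ℝ)..(s ^ α), f (ρ ^ (1 / α)) := by
    filter_upwards [lt_mem_nhds ht] with s hs using powerMean_eq hα f hs
  refine (h4.congr_of_eventuallyEq h5).congr_deriv ?_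
  rw [powerMean_eq hα f ht, ← Real.rpow_mul ht.le, mul_one_div_cancel hα.ne', Real.rpow_one,
    smul_sub, smul_smul, smul_smul, sub_eq_add_neg ((α / t) • f t), ← neg_smul]
  simp only [Function.comp]
  congr 2
  · rw [mul_left_comm, ← Real.rpow_add ht, div_eq_mul_inv, ← Real.rpow_neg_one]
    congr 2; ring
  · rw [Real.rpow_sub ht, Real.rpow_one]; ring

/-- Two solutions differ by a multiple of `t ^ (-α)`; continuity at `0` makes `t ^ α` times the
difference vanish there, which kills it. -/
theorem eq_powerMean (hα : 0 < α) {f y : ℝ → E} (hf : Continuous f) (hy : ContinuousOn y (Ici 0))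
    (hd : ∀ t, 0 < t → HasDerivAt y ((α / t) • (f t - y t)) t) {t : ℝ} (ht : 0 < t) :
    y t = powerMean α f t := by
  have hc : ContinuousOn (fun s : ℝ => s ^ α • (y s - powerMean α f s)) (Icc 0 t) := by
    refine ContinuousOn.smul ?_ ?_
    · exact (continuous_id.rpow_const fun _ => Or.inr hα.le).continuousOn
    · exact (hy.mono Icc_subset_Ici_self).sub (continuous_powerMean hα hf).continuousOn
  have h := intervalIntegral.integral_eq_sub_of_hasDerivAt_of_le ht.le hc (f' := fun _ => 0)
    (fun s hs => by
      have h1 : HasDerivAt (fun s : ℝ => s ^ α) (α * s ^ (α - 1)) s :=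
        Real.hasDerivAt_rpow_const (Or.inl hs.1.ne')
      refine (h1.smul ((hd s hs.1).sub (hasDerivAt_powerMean hα hf hs.1))).congr_deriv ?_
      rw [← smul_sub, smul_smul, Real.rpow_sub hs.1, Real.rpow_one]
      have e : f s - y s - (f s - powerMean α f s) = -(y s - powerMean α f s) := by abel
      simp only [Pi.sub_apply]
      rw [e, smul_neg, mul_div_assoc', mul_div_assoc', mul_comm α, neg_add_cancel])
    (by simp)
  rw [intervalIntegral.integral_zero, Real.zero_rpow hα.ne', zero_smul, sub_zero] at h
  have := (smul_eq_zero.1 h.symm).resolve_left (Real.rpow_pos_of_pos ht _).ne'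
  exact sub_eq_zero.1 this

/-- A maximum principle for the singular equation `y' = (α / t) (f - y)`. -/
theorem norm_le_of_singular_ode (hα : 0 < α) {f y : ℝ → E} (hf : ContinuousOn f (Ici 0))
    (hy : ContinuousOn y (Ici 0)) (hd : ∀ t, 0 < t → HasDerivAt y ((α / t) • (f t - y t)) t)
    {t C : ℝ} (ht : 0 < t) (hC : ∀ s ∈ Icc 0 t, ‖f s‖ ≤ C) : ‖y t‖ ≤ C := by
  have hf' : Continuous fun s => f (max s 0) :=
    hf.comp_continuous (by fun_prop) fun s => le_max_right s 0
  rw [eq_powerMean hα hf' hy (fun s hs => by simpa only [max_eq_left hs.le] using hd s hs) ht]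
  refine norm_powerMean_le hα ht.le fun s hs => ?_
  simpa only [max_eq_left hs.1] using hC s hs

end PowerMean

/-! ### Existence and uniqueness for the first-order form. -/

section Trajectory

variable {E : Type*} [NormedAddCommGroup E] [NormedSpace ℝ E]

/-- The velocity at time `t` of a lazy solution with positions `x`, where `G` is the gradient. -/
noncomputable def velocity (α β : ℝ) (G : E → E) (x : ℝ → E) (t : ℝ) : E :=
  powerMean α (fun s => (β - s / α) • G (x s)) t - β • G (x t)

/-- The exponent of the weight for which the velocity operator is a contraction. -/
noncomputable def weightExponent (α β L t : ℝ) : ℝ := 4 * β * L * t + L / α * t ^ 2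

/-- A position `x` and velocity `v` solving the first-order form of the equation, in which
`v + β G(x)` is the auxiliary unknown. -/
structure IsTrajectory (α β : ℝ) (G : E → E) (x v : ℝ → E) : Prop where
  hasDerivWithinAt : ∀ t, 0 ≤ t → HasDerivWithinAt x (v t) (Ici 0) t
  continuousOn_velocity : ContinuousOn v (Ici 0)
  hasDerivAt_aux : ∀ t, 0 < t → HasDerivAt (fun s => v s + β • G (x s))
    ((α / t) • ((β - t / α) • G (x t) - (v t + β • G (x t)))) t

variable {α β : ℝ} {L : ℝ≥0} {G : E → E}

theorem continuous_weightExponent (α β L : ℝ) : Continuous (weightExponent α β L) := by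
  unfold weightExponent; fun_prop

theorem weightExponent_mono (hα : 0 < α) (hβ : 0 < β) {s t : ℝ} (hs : 0 ≤ s) (hst : s ≤ t) :
    weightExponent α β L s ≤ weightExponent α β L t := by
  unfold weightExponent
  gcongr

theorem weightExponent_nonneg (hα : 0 < α) (hβ : 0 < β) {t : ℝ} (ht : 0 ≤ t) :
    0 ≤ weightExponent α β L t := by
  unfold weightExponent
  positivity

/-- The weight exponent has derivative `2L(2β + t/α)`, so integration gains a factor `1/(2L)`. With
`K = L * D` from the Lipschitz bound, this is the contraction factor `1/2`. -/
theorem norm_le_exp_weightExponent (hL : 0 < L) {u u' : ℝ → E}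
    {T K : ℝ} (hu : ContinuousOn u (Icc 0 T))
    (hd : ∀ s ∈ Ico 0 T, HasDerivWithinAt u (u' s) (Ici s) s) (h0 : u 0 = 0) (hK : 0 ≤ K)
    (hb : ∀ s ∈ Ico 0 T, ‖u' s‖ ≤ K * (2 * β + s / α) * Real.exp (weightExponent α β L s)) :
    ∀ t ∈ Icc 0 T, ‖u t‖ ≤ K / (2 * L) * Real.exp (weightExponent α β L t) := by
  have hL' : (0 : ℝ) < L := hL
  intro t ht
  refine image_norm_le_of_norm_deriv_right_le_deriv_boundary hu hd
    (B := fun t => K / (2 * L) * Real.exp (weightExponent α β L t)) ?_ ?_ hb ht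
  · rw [h0, norm_zero]; positivity
  · intro s
    have h1 : HasDerivAt (weightExponent α β L) (2 * L * (2 * β + s / α)) s := by
      have := ((hasDerivAt_id s).const_mul (4 * β * L)).add
        (((hasDerivAt_id s).pow 2).const_mul (L / α))
      refine (this.congr_deriv ?_)
      simp only [id]
      ring
    refine (h1.exp.const_mul (K / (2 * L))).congr_deriv ?_
    field_simp

theorem norm_forcing_sub_le (hα : 0 < α) (hβ : 0 < β) (hG : LipschitzWith L G) {a b : E} {s t D : ℝ}
    (hs : s ∈ Icc 0 t) (h : ‖a - b‖ ≤ D) :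
    ‖(β - s / α) • G a - (β - s / α) • G b‖ ≤ (β + t / α) * (L * D) := by
  rw [← smul_sub, norm_smul]
  have h1 : ‖β - s / α‖ ≤ β + t / α := by
    have : s / α ≤ t / α := by gcongr; exact hs.2
    have := div_nonneg hs.1 hα.le
    rw [Real.norm_eq_abs, abs_le]; constructor <;> linarith
  have h2 : ‖G a - G b‖ ≤ L * D :=
    (hG.norm_sub_le a b).trans (by gcongr)
  have : 0 ≤ β + t / α := by have := hs.1.trans hs.2; positivity
  gcongr

theorem norm_smul_sub_smul_le (hβ : 0 < β) (hG : LipschitzWith L G) {a b : E} {D : ℝ}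
    (h : ‖a - b‖ ≤ D) : ‖β • G a - β • G b‖ ≤ β * (L * D) := by
  rw [← smul_sub, norm_smul, Real.norm_eq_abs, abs_of_pos hβ]
  have h2 : ‖G a - G b‖ ≤ L * D := (hG.norm_sub_le a b).trans (by gcongr)
  gcongr

theorem continuous_forcing (hG : LipschitzWith L G) {x : ℝ → E} (hx : Continuous x) :
    Continuous fun s => (β - s / α) • G (x s) := by
  have := hG.continuous
  fun_prop

theorem continuous_velocity (hα : 0 < α) (hG : LipschitzWith L G) {x : ℝ → E}
    (hx : Continuous x) : Continuous (velocity α β G x) :=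
  (continuous_powerMean hα (continuous_forcing hG hx)).sub
    ((hG.continuous.comp hx).const_smul β)

theorem velocity_congr (hα : 0 < α) {x y : ℝ → E} {t : ℝ} (ht : 0 ≤ t) (h : EqOn x y (Icc 0 t)) :
    velocity α β G x t = velocity α β G y t := by
  unfold velocity
  rw [h ⟨ht, le_rfl⟩, powerMean_congr hα ht (g := fun s => (β - s / α) • G (y s))
    fun s hs => by simp only [h hs]]

theorem norm_velocity_sub_le (hα : 0 < α) (hβ : 0 < β) (hG : LipschitzWith L G) {x y : ℝ → E}
    (hx : Continuous x) (hy : Continuous y) {t D : ℝ} (ht : 0 ≤ t)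
    (h : ∀ s ∈ Icc 0 t, ‖x s - y s‖ ≤ D) :
    ‖velocity α β G x t - velocity α β G y t‖ ≤ L * D * (2 * β + t / α) := by
  have e : velocity α β G x t - velocity α β G y t =
      powerMean α (fun s => (β - s / α) • G (x s) - (β - s / α) • G (y s)) t
        - (β • G (x t) - β • G (y t)) := by
    rw [powerMean_sub hα (continuous_forcing hG hx) (continuous_forcing hG hy)]
    unfold velocity
    abel
  rw [e]
  refine (norm_sub_le _ _).trans ?_
  have h1 := norm_powerMean_le hα ht fun s hs => norm_forcing_sub_le hα hβ hG hs (h s hs)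
  have h2 := norm_smul_sub_smul_le hβ hG (h t ⟨ht, le_rfl⟩)
  linarith

theorem norm_velocity_const_le (hα : 0 < α) (hβ : 0 < β) (z : E) {t : ℝ} (ht : 0 ≤ t) :
    ‖velocity α β G (fun _ => z) t‖ ≤ ‖G z‖ * (2 * β + t / α) := by
  refine (norm_sub_le _ _).trans ?_
  have h1 : ‖powerMean α (fun s => (β - s / α) • G z) t‖ ≤ (β + t / α) * ‖G z‖ := by
    refine norm_powerMean_le hα ht fun s hs => ?_
    have : s / α ≤ t / α := by gcongr; exact hs.2
    have := div_nonneg hs.1 hα.le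
    rw [norm_smul]
    gcongr
    rw [Real.norm_eq_abs, abs_le]; constructor <;> linarith
  have h2 : ‖β • G z‖ = β * ‖G z‖ := by rw [norm_smul, Real.norm_eq_abs, abs_of_pos hβ]
  linarith

theorem IsTrajectory.continuousOn {x v : ℝ → E} (h : IsTrajectory α β G x v) :
    ContinuousOn x (Ici 0) := fun t ht => (h.hasDerivWithinAt t ht).continuousWithinAt

variable [CompleteSpace E]

theorem IsTrajectory.eqOn (hα : 0 < α) (hβ : 0 < β) (hL : 0 < L) (hG : LipschitzWith L G)
    {x v y w : ℝ → E} (hx : IsTrajectory α β G x v) (hy : IsTrajectory α β G y w)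
    (h0 : x 0 = y 0) : EqOn x y (Ici 0) := by
  intro T hT
  have hL' : (0 : ℝ) < L := hL
  have hd : ContinuousOn (fun t => x t - y t) (Ici 0) := hx.continuousOn.sub hy.continuousOn
  have hdT := hd.mono (Icc_subset_Ici_self : Icc 0 T ⊆ Ici 0)
  -- Let `S` be the weighted maximum of the difference. The integrated velocity bound at the
  -- maximizer gives `S ≤ S / 2`.
  obtain ⟨t₀, ht₀, hmax⟩ := isCompact_Icc.exists_isMaxOn (nonempty_Icc.2 hT)
    (f := fun t => Real.exp (-weightExponent α β L t) * ‖x t - y t‖)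
    ((Real.continuous_exp.comp (continuous_weightExponent α β L).neg).continuousOn.mul hdT.norm)
  set S := Real.exp (-weightExponent α β L t₀) * ‖x t₀ - y t₀‖ with hS
  have hS0 : 0 ≤ S := by positivity
  have key : ∀ s ∈ Icc 0 T, ‖x s - y s‖ ≤ S * Real.exp (weightExponent α β L s) := fun s hs => by
    have : Real.exp (-weightExponent α β L s) * ‖x s - y s‖ ≤ S := hmax hs
    rwa [Real.exp_neg, inv_mul_le_iff₀ (Real.exp_pos _), mul_comm] at this
  have hvel : ∀ t ∈ Ico 0 T, ‖v t - w t‖ ≤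
      L * S * (2 * β + t / α) * Real.exp (weightExponent α β L t) := by
    have hpos : ∀ t ∈ Ioo 0 T, ‖v t - w t‖ ≤
        L * S * (2 * β + t / α) * Real.exp (weightExponent α β L t) := fun t ht => by
      have hle : ∀ s ∈ Icc 0 t, ‖x s - y s‖ ≤ S * Real.exp (weightExponent α β L t) := fun s hs =>
        (key s ⟨hs.1, hs.2.trans ht.2.le⟩).trans (by
          gcongr; exact weightExponent_mono hα hβ hs.1 hs.2)
      have hGx := hG.continuous.comp_continuousOn hx.continuousOn
      have hGy := hG.continuous.comp_continuousOn hy.continuousOn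
      have h1 := norm_le_of_singular_ode hα
        (f := fun s => (β - s / α) • G (x s) - (β - s / α) • G (y s))
        (y := fun s => (v s + β • G (x s)) - (w s + β • G (y s)))
        (((Continuous.continuousOn (by fun_prop)).smul hGx).sub
          ((Continuous.continuousOn (by fun_prop)).smul hGy))
        ((hx.continuousOn_velocity.add (hGx.const_smul β)).sub
          (hy.continuousOn_velocity.add (hGy.const_smul β)))
        (fun s hs => ((hx.hasDerivAt_aux s hs).sub (hy.hasDerivAt_aux s hs)).congr_deriv (by
          rw [← smul_sub]; congr 1; abel))
        ht.1 (fun s hs => norm_forcing_sub_le hα hβ hG hs (hle s hs))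
      have h2 := norm_smul_sub_smul_le hβ hG (hle t ⟨ht.1.le, le_rfl⟩)
      have e : v t - w t = ((v t + β • G (x t)) - (w t + β • G (y t)))
          - (β • G (x t) - β • G (y t)) := by abel
      rw [e]
      refine (norm_sub_le _ _).trans ?_
      linarith
    intro t ht
    rcases ht.1.eq_or_lt with rfl | h
    -- The auxiliary equation is singular at `0`, so the bound there is a limit from the right.
    · have h3 : Tendsto (fun t => ‖v t - w t‖) (𝓝[>] 0) (𝓝 ‖v 0 - w 0‖) :=
        ((hx.continuousOn_velocity.sub hy.continuousOn_velocity).norm 0 self_mem_Ici).mono_left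
          (nhdsWithin_mono _ Ioi_subset_Ici_self)
      have h4 : Tendsto (fun t => L * S * (2 * β + t / α) * Real.exp (weightExponent α β L t))
          (𝓝[>] 0) (𝓝 (L * S * (2 * β + 0 / α) * Real.exp (weightExponent α β L 0))) := by
        apply Tendsto.mono_left _ nhdsWithin_le_nhds
        have := continuous_weightExponent α β L
        exact Continuous.tendsto
          (f := fun t => L * S * (2 * β + t / α) * Real.exp (weightExponent α β L t))
          (by fun_prop) 0
      exact le_of_tendsto_of_tendsto h3 h4 (by
        filter_upwards [Ioo_mem_nhdsGT ht.2] with s hs using hpos s hs)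
    · exact hpos t ⟨h, ht.2⟩
  have h5 := norm_le_exp_weightExponent hL hdT
    (fun s hs => ((hx.hasDerivWithinAt s hs.1).sub (hy.hasDerivWithinAt s hs.1)).mono
      (Ici_subset_Ici.2 hs.1)) (sub_eq_zero.2 h0) (by positivity) hvel t₀ ht₀
  have h6 : ‖x t₀ - y t₀‖ = S * Real.exp (weightExponent α β L t₀) := by
    rw [hS, Real.exp_neg]; field_simp
  have h7 : L * S / (2 * L) = S / 2 := by field_simp
  simp only [h6, h7] at h5
  have h8 : S ≤ S / 2 := le_of_mul_le_mul_right h5 (Real.exp_pos _)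
  have h9 : S = 0 := by linarith
  have := key T ⟨hT, le_rfl⟩
  rw [h9, zero_mul] at this
  exact sub_eq_zero.1 (norm_le_zero_iff.1 this)

theorem exists_hasDerivAt_velocity (hα : 0 < α) (hβ : 0 < β) (hL : 0 < L)
    (hG : LipschitzWith L G) (z : E) :
    ∃ x : ℝ → E, x 0 = z ∧ ∀ t, HasDerivAt x (velocity α β G x (max t 0)) t := by
  have hL' : (0 : ℝ) < L := hL
  let W : ℝ → ℝ := weightExponent α β L
  have hW : Continuous W := continuous_weightExponent α β L
  have hWm : ∀ {s t}, 0 ≤ s → s ≤ t → W s ≤ W t := fun h1 h2 => weightExponent_mono hα hβ h1 h2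
  -- Positions are encoded as `z + exp(W) v` with `v` bounded, so the sup norm of `v` is the
  -- weighted norm.
  let X : (BoundedContinuousFunction ℝ E) → ℝ → E := fun v t => z + Real.exp (W t) • v t
  have hX : ∀ v, Continuous (X v) := fun v => by fun_prop
  let I : (BoundedContinuousFunction ℝ E) → ℝ → E := fun v t =>
    ∫ s in (0 : ℝ)..t, velocity α β G (X v) s
  have hId : ∀ v t, HasDerivAt (I v) (velocity α β G (X v) t) t := fun v t =>
    ((continuous_velocity hα hG (hX v)).integral_hasStrictDerivAt 0 t).hasDerivAt
  have hI0 : ∀ v, I v 0 = 0 := fun v => intervalIntegral.integral_same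
  have hIc : ∀ v, Continuous (I v) := fun v =>
    continuous_iff_continuousAt.2 fun t => (hId v t).continuousAt
  have hXle : ∀ (u v : BoundedContinuousFunction ℝ E) {s t : ℝ}, s ∈ Icc 0 t →
      ‖X u s - X v s‖ ≤ dist u v * Real.exp (W t) := fun u v s t hs => by
    have e : X u s - X v s = Real.exp (W s) • (u s - v s) := by
      simp only [X, smul_sub]; abel
    rw [e, norm_smul, Real.norm_eq_abs, Real.abs_exp, mul_comm, ← dist_eq_norm]
    have := hWm hs.1 hs.2
    gcongr
    exact BoundedContinuousFunction.dist_coe_le_dist s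
  have hIle : ∀ v : BoundedContinuousFunction ℝ E, ∀ t, 0 ≤ t →
      ‖I v t‖ ≤ (L * ‖v‖ + ‖G z‖) / (2 * L) * Real.exp (W t) := fun v t ht => by
    refine norm_le_exp_weightExponent hL (T := t) (hIc v).continuousOn
      (fun s _ => (hId v s).hasDerivWithinAt) (hI0 v) (by positivity) (fun s hs => ?_)
      t ⟨ht, le_rfl⟩
    have h1 := norm_velocity_sub_le hα hβ hG (hX v) (hX 0) hs.1 fun r hr => hXle v 0 hr
    have h2 : X 0 = fun _ => z := by ext; simp [X]
    have h3 := norm_velocity_const_le hα hβ (G := G) z hs.1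
    have h4 : 1 ≤ Real.exp (W s) := Real.one_le_exp (weightExponent_nonneg hα hβ hs.1)
    have h5 : 0 ≤ ‖G z‖ * (2 * β + s / α) := by have := hs.1; positivity
    rw [h2, dist_zero_right] at h1
    have h6 := norm_sub_norm_le (velocity α β G (X v) s) (velocity α β G (fun _ => z) s)
    change _ ≤ (L * ‖v‖ + ‖G z‖) * (2 * β + s / α) * Real.exp (W s)
    nlinarith
  have hIsub : ∀ u v : BoundedContinuousFunction ℝ E, ∀ t, 0 ≤ t →
      ‖I u t - I v t‖ ≤ (L * dist u v) / (2 * L) * Real.exp (W t) := fun u v t ht => by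
    refine norm_le_exp_weightExponent hL (T := t) (u := fun t => I u t - I v t)
      ((hIc u).sub (hIc v)).continuousOn
      (fun s _ => ((hId u s).sub (hId v s)).hasDerivWithinAt) (by simp [hI0]) (by positivity)
      (fun s hs => ?_) t ⟨ht, le_rfl⟩
    have h1 := norm_velocity_sub_le hα hβ hG (hX u) (hX v) hs.1 fun r hr => hXle u v hr
    refine h1.trans (le_of_eq ?_)
    ring
  let F : BoundedContinuousFunction ℝ E → BoundedContinuousFunction ℝ E := fun v =>
    BoundedContinuousFunction.ofNormedAddCommGroup
      (fun t => Real.exp (-W (max t 0)) • I v (max t 0))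
      (by have := hIc v; fun_prop) ((L * ‖v‖ + ‖G z‖) / (2 * L)) (fun t => by
        rw [norm_smul, Real.norm_eq_abs, Real.abs_exp, Real.exp_neg,
          inv_mul_le_iff₀ (Real.exp_pos _), mul_comm]
        exact hIle v _ (le_max_right t 0))
  have hF : ContractingWith (1 / 2 : ℝ≥0) F := by
    refine ⟨by rw [← NNReal.coe_lt_coe]; norm_num, LipschitzWith.of_dist_le_mul fun u v => ?_⟩
    refine (BoundedContinuousFunction.dist_le (by positivity)).2 fun t => ?_
    have e : F u t - F v t = Real.exp (-W (max t 0)) • (I u (max t 0) - I v (max t 0)) := by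
      rw [smul_sub]; rfl
    rw [dist_eq_norm, e, norm_smul, Real.norm_eq_abs, Real.abs_exp, Real.exp_neg,
      inv_mul_le_iff₀ (Real.exp_pos _), mul_comm]
    refine (hIsub u v _ (le_max_right t 0)).trans (le_of_eq ?_)
    push_cast
    field_simp
  let v := hF.fixedPoint
  have hv : F v = v := hF.fixedPoint_isFixedPt
  have hXv : ∀ t, 0 ≤ t → X v t = z + I v t := fun t ht => by
    have h1 : v t = Real.exp (-W (max t 0)) • I v (max t 0) := by
      conv_lhs => rw [← hv]
      rfl
    simp only [X]
    rw [h1, max_eq_left ht, smul_smul, ← Real.exp_add, add_neg_cancel, Real.exp_zero, one_smul]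
  have hc : Continuous fun s => velocity α β G (X v) (max s 0) :=
    (continuous_velocity hα hG (hX v)).comp (by fun_prop)
  -- `X v` solves the integral equation only for `t ≥ 0`; this choice agrees with it there and is
  -- differentiable on all of `ℝ`.
  refine ⟨fun t => z + ∫ s in (0 : ℝ)..t, velocity α β G (X v) (max s 0), by simp, fun t => ?_⟩
  have h1 := (hc.integral_hasStrictDerivAt 0 t).hasDerivAt.const_add z
  refine h1.congr_deriv (velocity_congr hα (le_max_right t 0) fun s hs => ?_)
  rw [hXv s hs.1]
  congr 1
  refine intervalIntegral.integral_congr fun r hr => ?_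
  rw [uIcc_of_le hs.1] at hr
  simp only [max_eq_left hr.1]

end Trajectory

/-! ### Behaviour of the velocity near time zero. -/

section EarlyEstimates

variable {E : Type*} [NormedAddCommGroup E] [NormedSpace ℝ E] [CompleteSpace E]
  {α β : ℝ} {L : ℝ≥0} {G : E → E} {x v : ℝ → E}

omit [CompleteSpace E] in
theorem IsTrajectory.norm_sub_le (h : IsTrajectory α β G x v) {T V : ℝ}
    (hV : ∀ s ∈ Icc 0 T, ‖v s‖ ≤ V) {t : ℝ} (ht : t ∈ Icc 0 T) : ‖x t - x 0‖ ≤ V * t := by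
  have := norm_image_sub_le_of_norm_deriv_right_le_segment (f := x) (f' := v) (C := V) (a := 0)
    (b := T) (h.continuousOn.mono Icc_subset_Ici_self)
    (fun s hs => (h.hasDerivWithinAt s hs.1).mono (Ici_subset_Ici.2 hs.1))
    (fun s hs => hV s ⟨hs.1, hs.2.le⟩) t ht
  simpa using this

/-- With the gradient frozen at `x 0`, the auxiliary equation has the exact solution `(β - t/(α+1))
G(x 0)`. The maximum principle bounds the deviation from it. -/
theorem IsTrajectory.norm_velocity_add_le (hα : 0 < α) (hβ : 0 < β) (hG : LipschitzWith L G)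
    (h : IsTrajectory α β G x v) {T V : ℝ} (hT : 0 < T) (hV : ∀ s ∈ Icc 0 T, ‖v s‖ ≤ V) :
    ‖v T + (T / (α + 1)) • G (x 0)‖ ≤ (2 * β + T / α) * L * T * V := by
  have hV0 : 0 ≤ V := (norm_nonneg _).trans (hV 0 ⟨le_rfl, hT.le⟩)
  have hle : ∀ s ∈ Icc 0 T, ‖x s - x 0‖ ≤ V * T := fun s hs =>
    (h.norm_sub_le hV hs).trans (by gcongr; exact hs.2)
  have hGx := hG.continuous.comp_continuousOn h.continuousOn
  have h1 := norm_le_of_singular_ode hα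
    (f := fun s => (β - s / α) • G (x s) - (β - s / α) • G (x 0))
    (y := fun s => (v s + β • G (x s)) - β • G (x 0) + (s * (α + 1)⁻¹) • G (x 0))
    (((Continuous.continuousOn (by fun_prop)).smul hGx).sub
      (Continuous.continuousOn (by fun_prop)))
    (((h.continuousOn_velocity.add (hGx.const_smul β)).sub continuousOn_const).add
      (Continuous.continuousOn (by fun_prop)))
    (fun s hs => (((h.hasDerivAt_aux s hs).sub_const (β • G (x 0))).add
      (((hasDerivAt_id s).mul_const (α + 1)⁻¹).smul_const (G (x 0)))).congr_deriv (by
        have := hs.ne'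
        have := hα.ne'
        have : α + 1 ≠ 0 := by positivity
        simp only [one_mul]
        (match_scalars <;> field_simp); ring))
    hT (fun s hs => norm_forcing_sub_le hα hβ hG hs (hle s hs))
  have h2 := norm_smul_sub_smul_le hβ hG (hle T ⟨hT.le, le_rfl⟩)
  have e : v T + (T / (α + 1)) • G (x 0) =
      ((v T + β • G (x T)) - β • G (x 0) + (T * (α + 1)⁻¹) • G (x 0))
        - (β • G (x T) - β • G (x 0)) := by
    rw [div_eq_mul_inv]; abel
  rw [e]
  refine (_root_.norm_sub_le _ _).trans ?_
  linarith

/-- At the time where the speed is maximal on `[0, T]`, the error term is at most half that speed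
and can be absorbed. -/
theorem IsTrajectory.norm_velocity_le (hα : 0 < α) (hβ : 0 < β) (hG : LipschitzWith L G)
    (h : IsTrajectory α β G x v) (h0 : v 0 = 0) {T : ℝ} (hT : 0 < T)
    (hsmall : (2 * β + T / α) * L * T ≤ 1 / 2) {t : ℝ} (ht : t ∈ Icc 0 T) :
    ‖v t‖ ≤ 2 * (T / (α + 1) * ‖G (x 0)‖) := by
  obtain ⟨s, hs, hmax⟩ := isCompact_Icc.exists_isMaxOn (nonempty_Icc.2 hT.le)
    (h.continuousOn_velocity.mono (Icc_subset_Ici_self : Icc 0 T ⊆ Ici 0)).norm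
  have hmax' : ∀ r ∈ Icc 0 T, ‖v r‖ ≤ ‖v s‖ := fun r hr => hmax hr
  refine (hmax' t ht).trans ?_
  rcases hs.1.eq_or_lt with rfl | hs0
  · rw [h0, norm_zero]; positivity
  have h1 := h.norm_velocity_add_le hα hβ hG hs0
    (fun r hr => hmax' r ⟨hr.1, hr.2.trans hs.2⟩)
  have h2 : (2 * β + s / α) * L * s * ‖v s‖ ≤ 1 / 2 * ‖v s‖ := by
    have : (2 * β + s / α) * L * s ≤ (2 * β + T / α) * L * T := by
      have := hs.2
      gcongr
    gcongr
    exact this.trans hsmall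
  have h3 : ‖(s / (α + 1)) • G (x 0)‖ ≤ T / (α + 1) * ‖G (x 0)‖ := by
    rw [norm_smul, Real.norm_eq_abs, abs_of_pos (by positivity)]
    have := hs.2
    gcongr
  have h4 := norm_sub_norm_le (v s) (-((s / (α + 1)) • G (x 0)))
  rw [norm_neg, sub_neg_eq_add] at h4
  linarith

/-- Both expressions vanish at `0`. They are the relative error factors of velocity and acceleration
in `IsSolution.early_estimates`; they do not involve `z`, so `τ` is uniform. -/
theorem exists_early_time (α β L : ℝ) : ∃ τ, 0 < τ ∧ ∀ t ∈ Ioc 0 τ,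
    (2 * β + t / α) * L * t ≤ 1 / 8 ∧
      2 * α * ((2 * β + t / α) * L * t) + 2 * β * L * t + 2 * L * t ^ 2 ≤ 1 / 4 := by
  have h1 : ∀ᶠ t in 𝓝 (0 : ℝ), (2 * β + t / α) * L * t < 1 / 8 :=
    (Continuous.tendsto (f := fun t : ℝ => (2 * β + t / α) * L * t) (by fun_prop) 0).eventually_lt
      tendsto_const_nhds (by norm_num)
  have h2 : ∀ᶠ t in 𝓝 (0 : ℝ),
      2 * α * ((2 * β + t / α) * L * t) + 2 * β * L * t + 2 * L * t ^ 2 < 1 / 4 :=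
    (Continuous.tendsto (f := fun t : ℝ => 2 * α * ((2 * β + t / α) * L * t) + 2 * β * L * t
      + 2 * L * t ^ 2) (by fun_prop) 0).eventually_lt tendsto_const_nhds (by norm_num)
  obtain ⟨ε, hε, h⟩ := Metric.eventually_nhds_iff.1 (h1.and h2)
  refine ⟨ε / 2, by positivity, fun t ht => ?_⟩
  have := h (y := t) (by
    rw [Real.dist_eq, sub_zero, abs_of_pos ht.1]; linarith [ht.2])
  exact ⟨this.1.le, this.2.le⟩

end EarlyEstimates

/-- The inner product is at least `(1 - 1/4 - 1/4 - 1/16) p q ‖g‖²`. -/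
theorem inner_pos_of_norm_add_le {E : Type*} [NormedAddCommGroup E] [InnerProductSpace ℝ E]
    {a b g : E} {p q : ℝ} (hp : 0 < p) (hq : 0 < q) (hg : g ≠ 0)
    (ha : ‖a + p • g‖ ≤ 1 / 4 * (p * ‖g‖)) (hb : ‖b + q • g‖ ≤ 1 / 4 * (q * ‖g‖)) :
    0 < inner ℝ a b := by
  have hg' : 0 < ‖g‖ := norm_pos_iff.2 hg
  have e : inner ℝ a b = inner ℝ (a + p • g) (b + q • g) - q * inner ℝ (a + p • g) g
      - p * inner ℝ g (b + q • g) + p * q * ‖g‖ ^ 2 := by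
    simp only [inner_add_left, inner_add_right, real_inner_smul_left, real_inner_smul_right,
      real_inner_self_eq_norm_sq]
    ring
  have h1 := (abs_le.1 (abs_real_inner_le_norm (a + p • g) (b + q • g))).1
  have h2 := (abs_le.1 (abs_real_inner_le_norm (a + p • g) g)).2
  have h3 := (abs_le.1 (abs_real_inner_le_norm g (b + q • g))).2
  have h4 : ‖a + p • g‖ * ‖b + q • g‖ ≤ 1 / 4 * (p * ‖g‖) * (1 / 4 * (q * ‖g‖)) := by gcongr
  have h5 : q * inner ℝ (a + p • g) g ≤ q * (1 / 4 * (p * ‖g‖) * ‖g‖) := by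
    gcongr; exact h2.trans (by gcongr)
  have h6 : p * inner ℝ g (b + q • g) ≤ p * (‖g‖ * (1 / 4 * (q * ‖g‖))) := by
    gcongr; exact h3.trans (by gcongr)
  have h7 : 0 < p * q * ‖g‖ ^ 2 := by positivity
  rw [e]
  nlinarith

/-! ### Passage between the first- and second-order equations. -/

section Solutions

variable {n : ℕ} {φ : EuclideanSpace ℝ (Fin n) → ℝ} {α β lam μ : ℝ} {L : ℝ≥0}
  {z : EuclideanSpace ℝ (Fin n)} {x : ℝ → EuclideanSpace ℝ (Fin n)}

theorem hasDerivAt_velocity (hα : 0 < α) (hφ : ContDiff ℝ 2 φ) (hlip : LipschitzWith L (gradient φ))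
    (hx : Continuous x) {t : ℝ} {v : EuclideanSpace ℝ (Fin n)} (ht : 0 < t)
    (hd : HasDerivAt x v t) :
    HasDerivAt (velocity α β (gradient φ) x)
      ((α / t) • ((β - t / α) • gradient φ (x t)
        - powerMean α (fun s => (β - s / α) • gradient φ (x s)) t)
        - β • hessian φ (x t) v) t := by
  have h1 := hasDerivAt_powerMean hα (continuous_forcing (α := α) (β := β) hlip hx) ht
  have h2 := ((contDiff_gradient hφ).differentiable (by norm_num) (x t)).hasFDerivAt
  exact h1.sub ((h2.comp_hasDerivAt t hd).const_smul β)

theorem isSolution_of_hasDerivAt_velocity (hα : 0 < α) (hφ : ContDiff ℝ 2 φ)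
    (hlip : LipschitzWith L (gradient φ)) (h0 : x 0 = z)
    (hd : ∀ t, HasDerivAt x (velocity α β (gradient φ) x (max t 0)) t) :
    IsSolution φ α β z x := by
  have hx : Continuous x := continuous_iff_continuousAt.2 fun t => (hd t).continuousAt
  have hvc : Continuous (velocity α β (gradient φ) x) := continuous_velocity hα hlip hx
  have hdx : deriv x = fun t => velocity α β (gradient φ) x (max t 0) :=
    funext fun t => (hd t).deriv
  have hdpos : EqOn (deriv x) (velocity α β (gradient φ) x) (Ioi 0) := fun t ht => by
    rw [hdx]; simp only [max_eq_left (mem_Ioi.1 ht).le]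
  have hxC1 : ContDiff ℝ 1 x := contDiff_one_iff_deriv.2
    ⟨fun t => (hd t).differentiableAt, by rw [hdx]; fun_prop⟩
  have hd2 : ∀ t, 0 < t → HasDerivAt (velocity α β (gradient φ) x)
      ((α / t) • ((β - t / α) • gradient φ (x t)
        - powerMean α (fun s => (β - s / α) • gradient φ (x s)) t)
        - β • hessian φ (x t) (velocity α β (gradient φ) x t)) t := fun t ht => by
    have h := hd t
    rw [max_eq_left ht.le] at h
    exact hasDerivAt_velocity hα hφ hlip hx ht h
  have hG := contDiff_gradient hφ
  have hH : Continuous fun t => hessian φ (x t) :=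
    (hG.continuous_fderiv (by norm_num)).comp hx
  refine ⟨?_, hxC1.contDiffOn, h0, ?_, fun t ht => ?_⟩
  · have h2 : ContDiffOn ℝ (1 + 1) x (Ioi 0) := by
      rw [contDiffOn_succ_iff_deriv_of_isOpen isOpen_Ioi]
      refine ⟨fun t _ => (hd t).differentiableAt.differentiableWithinAt, by simp, ?_⟩
      refine ContDiffOn.congr ?_ hdpos
      have h1 : ContDiffOn ℝ (0 + 1) (velocity α β (gradient φ) x) (Ioi 0) := by
        rw [contDiffOn_succ_iff_deriv_of_isOpen isOpen_Ioi]
        refine ⟨fun t ht => (hd2 t ht).differentiableAt.differentiableWithinAt, by simp, ?_⟩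
        rw [contDiffOn_zero]
        refine ContinuousOn.congr ?_ fun t ht => (hd2 t ht).deriv
        have hp := continuous_powerMean hα (continuous_forcing (α := α) (β := β) hlip hx)
        have hb := hH.clm_apply hvc
        have ha : ContinuousOn (fun t : ℝ => α / t) (Ioi 0) :=
          continuousOn_const.div continuousOn_id fun t ht => (mem_Ioi.1 ht).ne'
        have hf := (continuous_forcing (α := α) (β := β) hlip hx).sub hp
        exact (ha.smul hf.continuousOn).sub (hb.const_smul β).continuousOn
      simpa using h1
    simpa [one_add_one_eq_two] using h2
  · refine ((hd 0).congr_deriv ?_).hasDerivWithinAt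
    simp [velocity, powerMean_zero]
  · have h1 : deriv x =ᶠ[𝓝 t] velocity α β (gradient φ) x := by
      filter_upwards [lt_mem_nhds ht] with s hs using hdpos hs
    rw [h1.deriv_eq, h1.eq_of_nhds, (hd2 t ht).deriv]
    have hv : powerMean α (fun s => (β - s / α) • gradient φ (x s)) t =
        velocity α β (gradient φ) x t + β • gradient φ (x t) := by
      unfold velocity; abel
    rw [hv]
    have := ht.ne'
    have := hα.ne'
    match_scalars <;> field_simp <;> ring

theorem IsSolution.hasDerivAt (h : IsSolution φ α β z x) {t : ℝ} (ht : 0 < t) :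
    HasDerivAt x (deriv x t) t :=
  ((h.contDiffOn_two.differentiableOn (by norm_num)).differentiableAt
    (Ioi_mem_nhds ht)).hasDerivAt

theorem IsSolution.hasDerivAt_deriv (h : IsSolution φ α β z x) {t : ℝ} (ht : 0 < t) :
    HasDerivAt (deriv x) (deriv (deriv x) t) t := by
  have h2 : ContDiffOn ℝ (1 + 1) x (Ioi 0) := by
    simpa [one_add_one_eq_two] using h.contDiffOn_two
  rw [contDiffOn_succ_iff_deriv_of_isOpen isOpen_Ioi] at h2
  exact ((h2.2.2.differentiableOn (by norm_num)).differentiableAt (Ioi_mem_nhds ht)).hasDerivAt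

theorem IsSolution.deriv_deriv (h : IsSolution φ α β z x) {t : ℝ} (ht : 0 < t) :
    deriv (deriv x) t = -((α / t) • deriv x t + β • hessian φ (x t) (deriv x t)
      + gradient φ (x t)) := by
  rw [eq_neg_iff_add_eq_zero, ← h.eqn t ht]; abel

theorem derivWithin_Ici_eq_deriv {x : ℝ → EuclideanSpace ℝ (Fin n)} {t : ℝ} (ht : 0 < t) :
    derivWithin x (Ici 0) t = deriv x t := derivWithin_of_mem_nhds (Ici_mem_nhds ht)

/-- The velocity is `derivWithin` because a solution is unconstrained for negative times, so `deriv
x 0` carries no information. -/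
theorem IsSolution.isTrajectory (hα : 0 < α) (hφ : ContDiff ℝ 2 φ) (h : IsSolution φ α β z x) :
    IsTrajectory α β (gradient φ) x (derivWithin x (Ici 0)) where
  hasDerivWithinAt t ht :=
    (h.contDiffOn_one.differentiableOn (by norm_num) t ht).hasDerivWithinAt
  continuousOn_velocity :=
    h.contDiffOn_one.continuousOn_derivWithin (uniqueDiffOn_Ici 0) (by norm_num)
  hasDerivAt_aux t ht := by
    have h1 : derivWithin x (Ici 0) =ᶠ[𝓝 t] deriv x := by
      filter_upwards [lt_mem_nhds ht] with s hs using derivWithin_Ici_eq_deriv hs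
    have h2 := ((contDiff_gradient hφ).differentiable (by norm_num) (x t)).hasFDerivAt
    have h3 := ((h.hasDerivAt_deriv ht).congr_of_eventuallyEq h1).add
      ((h2.comp_hasDerivAt t (h.hasDerivAt ht)).const_smul β)
    refine h3.congr_deriv ?_
    rw [h.deriv_deriv ht, derivWithin_Ici_eq_deriv ht]
    change _ + β • hessian φ (x t) (deriv x t) = _
    have := ht.ne'
    have := hα.ne'
    match_scalars <;> field_simp <;> ring

theorem IsSolution.eqOn (hα : 0 < α) (hβ : 0 < β) (hL : 0 < L) (hφ : ContDiff ℝ 2 φ)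
    (hlip : LipschitzWith L (gradient φ)) {y : ℝ → EuclideanSpace ℝ (Fin n)}
    (hx : IsSolution φ α β z x) (hy : IsSolution φ α β z y) : EqOn x y (Ici 0) :=
  (hx.isTrajectory hα hφ).eqOn hα hβ hL hlip (hy.isTrajectory hα hφ) (hx.init.trans hy.init.symm)

theorem IsSolution.derivWithin_zero (h : IsSolution φ α β z x) : derivWithin x (Ici 0) 0 = 0 :=
  h.init_deriv.derivWithin (uniqueDiffOn_Ici 0 0 self_mem_Ici)

theorem IsSolution.speedCriterion_eq (h : IsSolution φ α β z x) {t : ℝ} (ht : 0 < t) :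
    speedCriterion α lam x t =
      inner ℝ (deriv (deriv x) t) (deriv x t) + lam * (α / t) * ‖deriv x t‖ ^ 2 := by
  rw [speedCriterion, (h.hasDerivAt_deriv ht).norm_sq.deriv, real_inner_comm]
  ring

theorem norm_hessian_apply_le (hlip : LipschitzWith L (gradient φ))
    (y v : EuclideanSpace ℝ (Fin n)) : ‖hessian φ y v‖ ≤ L * ‖v‖ :=
  (hessian φ y).le_of_opNorm_le (norm_fderiv_le_of_lipschitz ℝ hlip) v

theorem mul_norm_sq_le_inner_hessian (hφ : ContDiff ℝ 2 φ) (hconv : StrongConvexOn univ μ φ)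
    (y v : EuclideanSpace ℝ (Fin n)) : μ * ‖v‖ ^ 2 ≤ inner ℝ (hessian φ y v) v :=
  mul_norm_sq_le_inner_fderiv ((contDiff_gradient hφ).differentiable (by norm_num) y)
    (fun w => mul_norm_sq_le_inner_gradient_sub hconv (hφ.differentiable (by norm_num)) y w) v

theorem IsSolution.early_estimates (hα : 0 < α) (hβ : 0 < β) (hφ : ContDiff ℝ 2 φ)
    (hlip : LipschitzWith L (gradient φ)) (h : IsSolution φ α β z x) (hz : gradient φ z ≠ 0)
    {t : ℝ} (ht : 0 < t) (h1 : (2 * β + t / α) * L * t ≤ 1 / 8)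
    (h2 : 2 * α * ((2 * β + t / α) * L * t) + 2 * β * L * t + 2 * L * t ^ 2 ≤ 1 / 4) :
    0 < inner ℝ (deriv (deriv x) t) (deriv x t) ∧
      t / (α + 1) * ‖gradient φ z‖ / 2 ≤ ‖deriv x t‖ := by
  have hT := h.isTrajectory hα hφ
  set g := gradient φ z with hg
  have hg0 : 0 < ‖g‖ := norm_pos_iff.2 hz
  have hV : ∀ s ∈ Icc 0 t, ‖derivWithin x (Ici 0) s‖ ≤ 2 * (t / (α + 1) * ‖g‖) := fun s hs => by
    have := hT.norm_velocity_le hα hβ hlip h.derivWithin_zero ht (by linarith) hs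
    rwa [h.init] at this
  have hv := hT.norm_velocity_add_le hα hβ hlip ht hV
  have hx := hT.norm_sub_le hV (t := t) ⟨ht.le, le_rfl⟩
  have hvt := hV t ⟨ht.le, le_rfl⟩
  rw [derivWithin_Ici_eq_deriv ht] at hv hvt
  rw [h.init] at hx hv
  have hb : ‖deriv x t + (t / (α + 1)) • g‖ ≤ 1 / 4 * (t / (α + 1) * ‖g‖) := by
    refine hv.trans ?_
    have : (2 * β + t / α) * L * t * (2 * (t / (α + 1) * ‖g‖)) ≤
      1 / 8 * (2 * (t / (α + 1) * ‖g‖)) := by gcongr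
    linarith
  have ha : ‖deriv (deriv x) t + (1 / (α + 1)) • g‖ ≤ 1 / 4 * (1 / (α + 1) * ‖g‖) := by
    -- Splitting `1/(α+1) = 1 - α/(α+1)` pairs the singular term with the velocity error, which
    -- cancels the `1/t`.
    have e : deriv (deriv x) t + (1 / (α + 1)) • g = -((α / t) • (deriv x t + (t / (α + 1)) • g)
        + β • hessian φ (x t) (deriv x t) + (gradient φ (x t) - gradient φ z)) := by
      rw [h.deriv_deriv ht, ← hg]
      have := ht.ne'
      have : α + 1 ≠ 0 := by positivity
      (match_scalars <;> field_simp); ring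
    rw [e, norm_neg]
    refine norm_add₃_le.trans ?_
    rw [norm_smul, norm_smul, Real.norm_eq_abs, Real.norm_eq_abs, abs_of_pos hβ,
      abs_of_pos (div_pos hα ht)]
    have i1 : α / t * ‖deriv x t + (t / (α + 1)) • g‖ ≤
        α / t * ((2 * β + t / α) * L * t * (2 * (t / (α + 1) * ‖g‖))) := by gcongr
    have i2 : β * ‖hessian φ (x t) (deriv x t)‖ ≤ β * (L * (2 * (t / (α + 1) * ‖g‖))) := by
      gcongr
      exact (norm_hessian_apply_le hlip _ _).trans (by gcongr)
    have i3 : ‖gradient φ (x t) - gradient φ z‖ ≤ L * (2 * (t / (α + 1) * ‖g‖) * t) :=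
      (hlip.norm_sub_le _ _).trans (by gcongr)
    have i4 : α / t * ((2 * β + t / α) * L * t * (2 * (t / (α + 1) * ‖g‖)))
        + β * (L * (2 * (t / (α + 1) * ‖g‖))) + L * (2 * (t / (α + 1) * ‖g‖) * t) =
        (2 * α * ((2 * β + t / α) * L * t) + 2 * β * L * t + 2 * L * t ^ 2)
          * (1 / (α + 1) * ‖g‖) := by
      field_simp
    have i5 : (2 * α * ((2 * β + t / α) * L * t) + 2 * β * L * t + 2 * L * t ^ 2)
          * (1 / (α + 1) * ‖g‖) ≤ 1 / 4 * (1 / (α + 1) * ‖g‖) := by gcongr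
    linarith
  refine ⟨inner_pos_of_norm_add_le (by positivity) (by positivity) hz ha hb, ?_⟩
  have h3 := norm_sub_norm_le ((t / (α + 1)) • g) (-deriv x t)
  rw [norm_neg, sub_neg_eq_add, add_comm _ (deriv x t), norm_smul, Real.norm_eq_abs,
    abs_of_pos (by positivity)] at h3
  have : 0 < t / (α + 1) * ‖g‖ := by positivity
  linarith

end Solutions

/-! ### Decrease of `φ` before the restart. -/

section Decrease

variable {n : ℕ} {φ : EuclideanSpace ℝ (Fin n) → ℝ} {α β lam μ : ℝ} {L : ℝ≥0}
  {z : EuclideanSpace ℝ (Fin n)} {x : ℝ → EuclideanSpace ℝ (Fin n)}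

theorem IsSolution.hasDerivAt_comp (hφ : ContDiff ℝ 2 φ) (h : IsSolution φ α β z x) {t : ℝ}
    (ht : 0 < t) :
    HasDerivAt (fun s => φ (x s)) (inner ℝ (gradient φ (x t)) (deriv x t)) t := by
  have h1 := (hφ.differentiable (by norm_num) (x t)).hasFDerivAt.comp_hasDerivAt t (h.hasDerivAt ht)
  rwa [gradient, InnerProductSpace.toDual_symm_apply]

theorem IsSolution.inner_gradient_le (hα : 0 < α) (hβ : 0 < β) (hφ : ContDiff ℝ 2 φ)
    (hconv : StrongConvexOn univ μ φ) (hlam_one : lam ≤ 1) (h : IsSolution φ α β z x) {t : ℝ}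
    (ht : 0 < t) (hC : 0 ≤ speedCriterion α lam x t) :
    inner ℝ (gradient φ (x t)) (deriv x t) ≤ -(β * μ * ‖deriv x t‖ ^ 2) := by
  rw [h.speedCriterion_eq ht, h.deriv_deriv ht] at hC
  simp only [inner_neg_left, inner_add_left, real_inner_smul_left, real_inner_self_eq_norm_sq] at hC
  have h1 := mul_le_mul_of_nonneg_left (mul_norm_sq_le_inner_hessian hφ hconv (x t) (deriv x t))
    hβ.le
  have h2 : lam * (α / t) * ‖deriv x t‖ ^ 2 ≤ 1 * (α / t) * ‖deriv x t‖ ^ 2 := by gcongr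
  linarith

theorem IsSolution.continuousOn_comp (hφ : ContDiff ℝ 2 φ) (h : IsSolution φ α β z x) :
    ContinuousOn (fun s => φ (x s)) (Ici 0) :=
  hφ.continuous.comp_continuousOn h.contDiffOn_one.continuousOn

theorem IsSolution.antitoneOn (hα : 0 < α) (hβ : 0 < β) (hφ : ContDiff ℝ 2 φ) (hμ : 0 < μ)
    (hconv : StrongConvexOn univ μ φ) (hlam_one : lam ≤ 1) (h : IsSolution φ α β z x)
    {D : Set ℝ} (hD : Convex ℝ D) (hD0 : D ⊆ Ici 0)
    (hC : ∀ t ∈ interior D, 0 ≤ speedCriterion α lam x t) :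
    AntitoneOn (fun s => φ (x s)) D := by
  have hpos : ∀ t ∈ interior D, 0 < t := fun t ht => by
    have := interior_mono hD0 ht
    rwa [interior_Ici] at this
  refine antitoneOn_of_deriv_nonpos hD ((h.continuousOn_comp hφ).mono hD0)
    (fun t ht => (h.hasDerivAt_comp hφ (hpos t ht)).differentiableAt.differentiableWithinAt)
    fun t ht => ?_
  rw [(h.hasDerivAt_comp hφ (hpos t ht)).deriv]
  refine (h.inner_gradient_le hα hβ hφ hconv hlam_one (hpos t ht) (hC t ht)).trans ?_
  have : 0 ≤ β * μ * ‖deriv x t‖ ^ 2 := by positivity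
  linarith

theorem IsSolution.decrease_of_le_norm_deriv (hα : 0 < α) (hβ : 0 < β) (hφ : ContDiff ℝ 2 φ)
    (hμ : 0 < μ) (hconv : StrongConvexOn univ μ φ) (hlam_one : lam ≤ 1)
    (h : IsSolution φ α β z x) {τ k : ℝ} (hτ : 0 < τ) (hk : 0 ≤ k)
    (hC : ∀ t ∈ Ioc 0 τ, 0 ≤ speedCriterion α lam x t)
    (hv : ∀ t ∈ Ioc 0 τ, t * k ≤ ‖deriv x t‖) :
    φ (x τ) + β * μ * k ^ 2 * τ ^ 3 / 3 ≤ φ z := by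
  have hd : ∀ t ∈ Ioo 0 τ, HasDerivAt (fun s => φ (x s) + β * μ * k ^ 2 / 3 * s ^ 3)
      (inner ℝ (gradient φ (x t)) (deriv x t) + β * μ * k ^ 2 / 3 * (3 * t ^ 2)) t := fun t ht => by
    have := ((hasDerivAt_pow 3 t).const_mul (β * μ * k ^ 2 / 3))
    exact ((h.hasDerivAt_comp hφ ht.1).add this).congr_deriv (by norm_num)
  have hanti : AntitoneOn (fun s => φ (x s) + β * μ * k ^ 2 / 3 * s ^ 3) (Icc 0 τ) := by
    refine antitoneOn_of_deriv_nonpos (convex_Icc 0 τ)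
      (((h.continuousOn_comp hφ).mono Icc_subset_Ici_self).add (by fun_prop)) ?_ ?_
    · rw [interior_Icc]
      exact fun t ht => (hd t ht).differentiableAt.differentiableWithinAt
    · rw [interior_Icc]
      intro t ht
      rw [(hd t ht).deriv]
      have ht' : t ∈ Ioc 0 τ := ⟨ht.1, ht.2.le⟩
      have h1 := h.inner_gradient_le hα hβ hφ hconv hlam_one ht.1 (hC t ht')
      have h2 : (t * k) ^ 2 ≤ ‖deriv x t‖ ^ 2 :=
        pow_le_pow_left₀ (mul_nonneg ht.1.le hk) (hv t ht') 2
      have h3 := mul_le_mul_of_nonneg_left h2 (mul_pos hβ hμ).le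
      linarith
  have := hanti (left_mem_Icc.2 hτ.le) (right_mem_Icc.2 hτ.le) hτ.le
  simp only [h.init] at this
  linarith

/-- The derivative is `‖x'‖² + 2t⟨x'', x'⟩ ≥ (1 - 2λα)‖x'‖²`; this is where `λ ≤ 1/(2α)` enters. -/
theorem IsSolution.monotoneOn_mul_norm_deriv_sq (hα : 0 < α) (hlam : lam ≤ 1 / (2 * α))
    (h : IsSolution φ α β z x) {T : ℝ} (hC : ∀ t ∈ Ioc 0 T, 0 ≤ speedCriterion α lam x t) :
    MonotoneOn (fun t => t * ‖deriv x t‖ ^ 2) (Ioc 0 T) := by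
  have hd : ∀ t, 0 < t → HasDerivAt (fun t => t * ‖deriv x t‖ ^ 2)
      (1 * ‖deriv x t‖ ^ 2 + t * (2 * inner ℝ (deriv x t) (deriv (deriv x) t))) t := fun t ht =>
    (hasDerivAt_id t).mul (h.hasDerivAt_deriv ht).norm_sq
  refine monotoneOn_of_deriv_nonneg (convex_Ioc 0 T)
    (fun t ht => (hd t ht.1).continuousAt.continuousWithinAt) ?_ ?_
  · rw [interior_Ioc]
    exact fun t ht => (hd t ht.1).differentiableAt.differentiableWithinAt
  · rw [interior_Ioc]
    intro t ht
    have h1 := hC t ⟨ht.1, ht.2.le⟩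
    rw [h.speedCriterion_eq ht.1, real_inner_comm] at h1
    rw [(hd t ht.1).deriv]
    have h2 : t * (lam * (α / t) * ‖deriv x t‖ ^ 2) = lam * α * ‖deriv x t‖ ^ 2 := by
      have := ht.1.ne'
      field_simp
    have h3 := mul_nonneg ht.1.le h1
    rw [mul_add, h2] at h3
    have h4 : lam * α * ‖deriv x t‖ ^ 2 ≤ 1 / 2 * ‖deriv x t‖ ^ 2 := by
      gcongr
      rw [le_div_iff₀ (by positivity)] at hlam
      linarith
    linarith

theorem IsSolution.decrease_log (hα : 0 < α) (hβ : 0 < β) (hφ : ContDiff ℝ 2 φ)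
    (hμ : 0 < μ) (hconv : StrongConvexOn univ μ φ) (hlam_one : lam ≤ 1)
    (hlam : lam ≤ 1 / (2 * α)) (h : IsSolution φ α β z x) {τ T : ℝ} (hτ : 0 < τ) (hT : τ ≤ T)
    (hC : ∀ t ∈ Ioc 0 T, 0 ≤ speedCriterion α lam x t) :
    φ (x T) + β * μ * (τ * ‖deriv x τ‖ ^ 2) * (Real.log T - Real.log τ) ≤ φ (x τ) := by
  set K := τ * ‖deriv x τ‖ ^ 2 with hK
  have hmono := h.monotoneOn_mul_norm_deriv_sq hα hlam hC
  have hd : ∀ t, 0 < t → HasDerivAt (fun s => φ (x s) + β * μ * K * Real.log s)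
      (inner ℝ (gradient φ (x t)) (deriv x t) + β * μ * K * t⁻¹) t := fun t ht =>
    (h.hasDerivAt_comp hφ ht).add ((Real.hasDerivAt_log ht.ne').const_mul _)
  have hanti : AntitoneOn (fun s => φ (x s) + β * μ * K * Real.log s) (Icc τ T) := by
    refine antitoneOn_of_deriv_nonpos (convex_Icc τ T)
      (fun t ht => (hd t (hτ.trans_le ht.1)).continuousAt.continuousWithinAt) ?_ ?_
    · rw [interior_Icc]
      exact fun t ht => (hd t (hτ.trans ht.1)).differentiableAt.differentiableWithinAt
    · rw [interior_Icc]
      intro t ht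
      have ht0 := hτ.trans ht.1
      rw [(hd t ht0).deriv]
      have h1 := h.inner_gradient_le hα hβ hφ hconv hlam_one ht0 (hC t ⟨ht0, ht.2.le⟩)
      have h2 : K ≤ t * ‖deriv x t‖ ^ 2 := hmono ⟨hτ, hT⟩ ⟨ht0, ht.2.le⟩ ht.1.le
      have h3 : K * t⁻¹ ≤ ‖deriv x t‖ ^ 2 := by
        rw [← div_eq_mul_inv, div_le_iff₀ ht0]; linarith
      have h4 := mul_le_mul_of_nonneg_left h3 (mul_pos hβ hμ).le
      linarith
  have := hanti (left_mem_Icc.2 hT) (right_mem_Icc.2 hT) hT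
  simp only at this
  linarith

theorem speedCriterion_pos_of_lt_restartTime {t : ℝ} (ht : 0 < t)
    (h : ENNReal.ofReal t < restartTime α lam x) : 0 < speedCriterion α lam x t := by
  by_contra! hC
  exact h.not_ge (sInf_le ⟨t, ⟨ht, hC⟩, rfl⟩)

end Decrease

end DinAvd

/-! ### Assembly of the bounds. -/

theorem mainTheorem2 (n : ℕ) (φ : EuclideanSpace ℝ (Fin n) → ℝ)
    (hφ : ContDiff ℝ 2 φ)
    (μ : ℝ) (hμ : 0 < μ) (hconv : StrongConvexOn univ μ φ)
    (L : ℝ≥0) (hL : 0 < L) (hlip : LipschitzWith L (gradient φ))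
    (xmin : EuclideanSpace ℝ (Fin n)) (hmin : IsMinOn φ univ xmin)
    (α β lam : ℝ) (hα : 0 < α) (hβ : 0 < β)
    (hlam_nonneg : 0 ≤ lam) (hlam_one : lam ≤ 1) (hlam : lam ≤ 1 / (2 * α)) :
    ∃ x : EuclideanSpace ℝ (Fin n) → ℝ → EuclideanSpace ℝ (Fin n),
      (∀ z, DinAvd.IsSolution φ α β z (x z) ∧
        ∀ y, DinAvd.IsSolution φ α β z y → EqOn y (x z) (Ici 0)) ∧
      DinAvd.IsProper φ (φ xmin) x (fun z => DinAvd.restartTime α lam (x z)) := by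
  choose x hx0 hx using DinAvd.exists_hasDerivAt_velocity hα hβ hL hlip
  have hsol : ∀ z, DinAvd.IsSolution φ α β z (x z) := fun z =>
    DinAvd.isSolution_of_hasDerivAt_velocity hα hφ hlip (hx0 z) (hx z)
  refine ⟨x, fun z => ⟨hsol z, fun y hy => hy.eqOn hα hβ hL hφ hlip (hsol z)⟩, ?_⟩
  obtain ⟨τ, hτ, hearly⟩ := DinAvd.exists_early_time α β L
  have hgap : ∀ z, z ∉ DinAvd.argmin φ → φ xmin < φ z := fun z hz => by
    by_contra! hle
    exact hz fun y _ => hle.trans (hmin (mem_univ y))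
  have hPL : ∀ z, 2 * μ * (φ z - φ xmin) ≤ ‖gradient φ z‖ ^ 2 := fun z =>
    DinAvd.two_mul_mul_sub_le_norm_gradient_sq hμ hconv (hφ.differentiable (by norm_num) z) xmin
  have hgrad : ∀ z, z ∉ DinAvd.argmin φ → gradient φ z ≠ 0 := fun z hz h0 => by
    have h1 := hPL z
    rw [h0, norm_zero] at h1
    have := mul_pos hμ (sub_pos.2 (hgap z hz))
    linarith
  have hest : ∀ z, z ∉ DinAvd.argmin φ → ∀ t ∈ Ioc 0 τ,
      0 < DinAvd.speedCriterion α lam (x z) t ∧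
        t * (‖gradient φ z‖ / (2 * (α + 1))) ≤ ‖deriv (x z) t‖ := fun z hz t ht => by
    have h := (hsol z).early_estimates hα hβ hφ hlip (hgrad z hz) ht.1
      (hearly t ht).1 (hearly t ht).2
    refine ⟨?_, (le_of_eq ?_).trans h.2⟩
    · rw [(hsol z).speedCriterion_eq ht.1]
      have := ht.1
      have : 0 ≤ lam * (α / t) * ‖deriv (x z) t‖ ^ 2 := by positivity
      linarith [h.1]
    · field_simp
  have hlow : ∀ z, z ∉ DinAvd.argmin φ →
      ENNReal.ofReal τ ≤ DinAvd.restartTime α lam (x z) := fun z hz => by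
    refine le_sInf ?_
    rintro _ ⟨t, ⟨ht, hC⟩, rfl⟩
    refine ENNReal.ofReal_le_ofReal (le_of_not_ge fun hle => ?_)
    exact hC.not_gt (hest z hz t ⟨ht, hle⟩).1
  -- `κ` comes from `βμk²τ³/3` with `k = ‖∇φ(z)‖/(2(α+1))` and `‖∇φ(z)‖² ≥ 2μ(φ(z) - φ*)`.
  set κ : ℝ := β * μ ^ 2 * τ ^ 3 / (6 * (α + 1) ^ 2) with hκ
  have hκ0 : 0 < κ := by positivity
  have hdec : ∀ z, z ∉ DinAvd.argmin φ → φ (x z τ) + κ * (φ z - φ xmin) ≤ φ z := fun z hz => by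
    have h1 := (hsol z).decrease_of_le_norm_deriv hα hβ hφ hμ hconv hlam_one hτ
      (k := ‖gradient φ z‖ / (2 * (α + 1))) (by positivity)
      (fun t ht => (hest z hz t ht).1.le) (fun t ht => (hest z hz t ht).2)
    have h2 := mul_le_mul_of_nonneg_left (hPL z)
      (by positivity : 0 ≤ β * μ * τ ^ 3 / (12 * (α + 1) ^ 2))
    have e1 : β * μ * τ ^ 3 / (12 * (α + 1) ^ 2) * (2 * μ * (φ z - φ xmin)) =
        κ * (φ z - φ xmin) := by rw [hκ]; field_simp; ring
    have e2 : β * μ * τ ^ 3 / (12 * (α + 1) ^ 2) * ‖gradient φ z‖ ^ 2 =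
        β * μ * (‖gradient φ z‖ / (2 * (α + 1))) ^ 2 * τ ^ 3 / 3 := by field_simp; ring
    linarith
  have hanti : ∀ z, AntitoneOn (fun t => φ (x z t))
      {t : ℝ | 0 ≤ t ∧ ENNReal.ofReal t ≤ DinAvd.restartTime α lam (x z)} := fun z => by
    have hord : OrdConnected
        {t : ℝ | 0 ≤ t ∧ ENNReal.ofReal t ≤ DinAvd.restartTime α lam (x z)} :=
      ⟨fun a ha b hb t ht => ⟨ha.1.trans ht.1, (ENNReal.ofReal_le_ofReal ht.2).trans hb.2⟩⟩
    refine (hsol z).antitoneOn hα hβ hφ hμ hconv hlam_one hord.convex (fun t ht => ht.1)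
      fun t ht => ?_
    have ht0 : 0 < t := by
      have := interior_mono (show _ ⊆ Ici (0 : ℝ) from fun t ht => ht.1) ht
      rwa [interior_Ici] at this
    obtain ⟨ε, hε, hball⟩ := Metric.mem_nhds_iff.1 (mem_interior_iff_mem_nhds.1 ht)
    -- An interior time has a later time still in the set, hence lies strictly before the restart.
    have hmem := hball (show t + ε / 2 ∈ Metric.ball t ε by
      rw [Metric.mem_ball, Real.dist_eq, add_sub_cancel_left, abs_of_pos (by positivity)]
      linarith)
    refine (DinAvd.speedCriterion_pos_of_lt_restartTime ht0 (lt_of_lt_of_le ?_ hmem.2)).le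
    exact (ENNReal.ofReal_lt_ofReal_iff (by linarith)).2 (by linarith)
  have hup : ∀ z, z ∉ DinAvd.argmin φ → DinAvd.restartTime α lam (x z) ≤
      ENNReal.ofReal (τ * Real.exp (1 / (3 * κ) + 1)) := fun z hz => by
    -- Past `τ` the loss is at least `3κ log(T/τ)` times the gap; `1/(3κ)` uses up the gap and the
    -- extra `1` makes the contradiction strict.
    set T := τ * Real.exp (1 / (3 * κ) + 1) with hT
    have hT0 : 0 < T := by positivity
    have hτT : τ ≤ T := le_mul_of_one_le_right hτ.le (Real.one_le_exp (by positivity))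
    by_contra! hlt
    have hC : ∀ t ∈ Ioc 0 T, 0 ≤ DinAvd.speedCriterion α lam (x z) t := fun t ht =>
      (DinAvd.speedCriterion_pos_of_lt_restartTime ht.1
        ((ENNReal.ofReal_le_ofReal ht.2).trans_lt hlt)).le
    have h1 := (hsol z).decrease_log hα hβ hφ hμ hconv hlam_one hlam hτ hτT hC
    have hlog : Real.log T - Real.log τ = 1 / (3 * κ) + 1 := by
      rw [hT, Real.log_mul hτ.ne' (Real.exp_pos _).ne', Real.log_exp]; ring
    rw [hlog] at h1
    have hΔ := sub_pos.2 (hgap z hz)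
    have h2 : 3 * κ * (φ z - φ xmin) ≤ β * μ * (τ * ‖deriv (x z) τ‖ ^ 2) := by
      have h3 := pow_le_pow_left₀ (by positivity) (hest z hz τ ⟨hτ, le_rfl⟩).2 2
      have h4 := mul_le_mul_of_nonneg_left h3 (by positivity : 0 ≤ β * μ * τ)
      have h5 := mul_le_mul_of_nonneg_left (hPL z)
        (by positivity : 0 ≤ β * μ * τ ^ 3 / (4 * (α + 1) ^ 2))
      have e1 : β * μ * τ ^ 3 / (4 * (α + 1) ^ 2) * (2 * μ * (φ z - φ xmin)) =
          3 * κ * (φ z - φ xmin) := by rw [hκ]; field_simp; ring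
      have e2 : β * μ * τ ^ 3 / (4 * (α + 1) ^ 2) * ‖gradient φ z‖ ^ 2 =
          β * μ * τ * (τ * (‖gradient φ z‖ / (2 * (α + 1)))) ^ 2 := by field_simp; ring
      linarith
    have h6 := mul_le_mul_of_nonneg_right h2 (by positivity : 0 ≤ 1 / (3 * κ) + 1)
    have e3 : 3 * κ * (φ z - φ xmin) * (1 / (3 * κ) + 1) =
        (φ z - φ xmin) + 3 * (κ * (φ z - φ xmin)) := by field_simp
    have h7 : φ xmin ≤ φ (x z T) := hmin (mem_univ _)
    have h8 := hdec z hz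
    have h9 : 0 < κ * (φ z - φ xmin) := by positivity
    linarith
  -- The maximum with `1/2` keeps `Q` positive without proving `κ < 1`.
  refine ⟨⟨τ, _, hτ, by positivity, fun z hz => ⟨hlow z hz, hup z hz⟩⟩, hanti,
    max (1 - κ) (1 / 2), lt_max_of_lt_right (by norm_num),
    max_lt (by linarith) (by norm_num), fun z hz => ?_⟩
  have htop : DinAvd.restartTime α lam (x z) ≠ ⊤ := ne_top_of_le_ne_top ENNReal.ofReal_ne_top
    (hup z hz)
  have hle : τ ≤ (DinAvd.restartTime α lam (x z)).toReal :=
    (ENNReal.ofReal_le_iff_le_toReal htop).1 (hlow z hz)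
  have h1 : φ (x z (DinAvd.restartTime α lam (x z)).toReal) ≤ φ (x z τ) :=
    hanti z ⟨hτ.le, hlow z hz⟩ ⟨ENNReal.toReal_nonneg, (ENNReal.ofReal_toReal htop).le⟩ hle
  have h2 := hdec z hz
  have h3 : (1 - κ) * (φ z - φ xmin) ≤ max (1 - κ) (1 / 2) * (φ z - φ xmin) :=
    mul_le_mul_of_nonneg_right (le_max_left _ _) (sub_pos.2 (hgap z hz)).le
  linarith
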